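/- Let $\mathcal X$ be a finite set, let $n\ge 1$, $L\ge 1$, $m\ge 1$, and let $\sigma_0,\sigma_1,\sigma_2,\sigma_3$ be the Pauli matrices ($\sigma_0=I$). The $n$-qubit Pauli group $\mathbf P_n$ consists of the operators $\lambda\,\sigma_{i_1}\otimes\cdots\otimes\sigma_{i_n}$ on $(\mathbb C^2)^{\otimes n}$ with $\lambda\in\{\pm1,\pm i\}$, and the Clifford group $\mathbf C_n$ consists of the unitaries $U$ with $U\mathbf P_nU^\dagger\subseteq\mathbf P_n$. For $x\in\mathcal X$ and $\theta\in\mathbb R^L$ let $$U_{x,\theta}=U_x^{(L)}e^{-i\frac{\theta_L}{2}P_L}\cdots U_x^{(1)}e^{-i\frac{\theta_1}{2}P_1}U_x^{(0)},\qquad f_\theta(x)=\langle 0^n|U_{x,\theta}^\dagger\,O\,U_{x,\theta}|0^n\rangle,$$ where $U_x^{(0)},\dots,U_x^{(L)}\in\mathbf C_n$ may depend arbitrarily on $x$, the operators $P_1,\dots,P_L\in\mathbf P_n$ are self-adjoint, and $O=\sum_{k=1}^m c_kQ_k$ with $c_k\in[-1,1]$ and self-adjoint $Q_k\in\mathbf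 P_n$. Put $\|f\|_\infty=\sup_{x\in\mathcal X,\ \theta\in[0,2\pi)^L}|f_\theta(x)|$. The analytic neural tangent kernel is $K(x,x')=\mathbb E_\theta\big[\nabla_\theta f_\theta(x)^T\,\nabla_\theta f_\theta(x')\big]$, where the entries of $\theta$ are independent and uniform on $[0,2\pi)$. Let $N\ge1$ and let $\theta^{(1)},\dots,\theta^{(N)}$ be independent random vectors, each uniformly distributed on $\{0,\frac\pi2,\pi,\frac{3\pi}2\}^L$. With $e_i$ the $i$-th canonical basis vector of $\mathbb R^L$, define the estimator $$\tilde K(x,x')=\frac1{4N}\sum_{j=1}^N\sum_{i=1}^L\Big(f_{\theta^{(j)}+\frac\pi2e_i}(x)-f_{\theta^{(j)}-\frac\pi2e_i}(x)\Big)\Big(f_{\theta^{(j)}+\frac\pi2e_i}(x')-f_{\theta^{(j)}-\frac\pi2e_i}(x')\Big).$$ Given training inputs $x^{(1)},\dots,x^{(d_{\mathrm{train}})}\in\mathcal X$, $d_{\mathrm{train}}\ge1$, let $K_{\mathrm{train}}=\big(K(x^{(a)},x^{(b)})\big)_{a,b}$ and $\tilde K_{\mathrm{train}}=\big(\tilde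 K(x^{(a)},x^{(b)})\big)_{a,b}$, and let $\|\cdot\|_{\mathrm{op}}$ be the operator norm with respect to the Euclidean norm. Then for every $t$ with $0<t\le\|f\|_\infty^2$, $$\mathbb P\left\{\big\|\tilde K_{\mathrm{train}}-K_{\mathrm{train}}\big\|_{\mathrm{op}}\ge t\right\}\le 2\,d_{\mathrm{train}}\exp\left(-\frac{3\,N\,t^2}{8\,L^2\,d_{\mathrm{train}}^2\,\|f\|_\infty^4}\right).$$ -/

import Mathlib

open scoped Matrix

noncomputable section

namespace CliffordQNN

/-- Index set of the computational basis of `(ℂ²)^{⊗ n}`. -/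
abbrev Basis (n : ℕ) : Type := Fin n → Fin 2

/-- Linear operators on `(ℂ²)^{⊗ n}`, written in the computational basis. -/
abbrev Op (n : ℕ) : Type := Matrix (Basis n) (Basis n) ℂ

/-- The Pauli matrices `σ₀, σ₁, σ₂, σ₃`. -/
def pauliMatrix : Fin 4 → Matrix (Fin 2) (Fin 2) ℂ :=
  ![!![1, 0; 0, 1],
    !![0, 1; 1, 0],
    !![0, -Complex.I; Complex.I, 0],
    !![1, 0; 0, -1]]

/-- The tensor product `σ_{s 0} ⊗ ⋯ ⊗ σ_{s (n-1)}`; its matrix entries in the product basis are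
the products of the entries of the factors. -/
def pauliString {n : ℕ} (s : Fin n → Fin 4) : Op n :=
  Matrix.of fun a b => ∏ k, pauliMatrix (s k) (a k) (b k)

/-- The `n`-qubit Pauli group. -/
def pauliGroup (n : ℕ) : Set (Op n) :=
  {A | ∃ c ∈ ({1, -1, Complex.I, -Complex.I} : Set ℂ), ∃ s : Fin n → Fin 4,
    A = c • pauliString s}

/-- The `n`-qubit Clifford group. -/
def cliffordGroup (n : ℕ) : Set (Op n) :=
  {U | U ∈ Matrix.unitaryGroup (Basis n) ℂ ∧
    ∀ A ∈ pauliGroup n, U * A * Uᴴ ∈ pauliGroup n}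

/-- The data of a quantum neural network on `n` qubits with `L` parameters, input set `X`, and an
observable given as a combination of `m` Pauli operators. -/
structure QNN (X : Type*) (n L m : ℕ) where
  /-- The input-dependent nonparametric gates `U_x^{(0)}, …, U_x^{(L)}`. -/
  gate : X → Fin (L + 1) → Op n
  gate_mem : ∀ x l, gate x l ∈ cliffordGroup n
  /-- The generators `P_1, …, P_L` of the parametric gates. -/
  gen : Fin L → Op n
  gen_mem : ∀ l, gen l ∈ pauliGroup n
  gen_selfAdjoint : ∀ l, (gen l).IsHermitian
  /-- The coefficients of the observable. -/
  coeff : Fin m → ℝ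
  coeff_mem : ∀ k, coeff k ∈ Set.Icc (-1 : ℝ) 1
  /-- The Pauli terms of the observable. -/
  term : Fin m → Op n
  term_mem : ∀ k, term k ∈ pauliGroup n
  term_selfAdjoint : ∀ k, (term k).IsHermitian

/-- The Pauli rotation `exp (-i (φ / 2) A)`. -/
def rotation {n : ℕ} (A : Op n) (φ : ℝ) : Op n :=
  NormedSpace.exp ((-(Complex.I * ((φ / 2 : ℝ) : ℂ))) • A)

/-- The state vector `|0ⁿ⟩`. -/
def zeroState (n : ℕ) : Basis n → ℂ := Pi.single 0 1

namespace QNN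

variable {X : Type*} {n L m : ℕ}

/-- The measured observable `O = ∑ₖ cₖ Pₖ`. -/
def observable (Q : QNN X n L m) : Op n :=
  ∑ k, (Q.coeff k : ℂ) • Q.term k

/-- The circuit
`U_x^{(L)} e^{-i θ_L P_L / 2} ⋯ U_x^{(1)} e^{-i θ_1 P_1 / 2} U_x^{(0)}`. -/
def circuit (Q : QNN X n L m) (θ : Fin L → ℝ) (x : X) : Op n :=
  (List.ofFn fun l : Fin L => Q.gate x l.succ * rotation (Q.gen l) (θ l)).reverse.prod *
    Q.gate x 0

/-- The model function `f_θ(x) = ⟨0ⁿ| U† O U |0ⁿ⟩`. The observable is Hermitian, so the number is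
real, and `re` only changes its type. -/
def model (Q : QNN X n L m) (θ : Fin L → ℝ) (x : X) : ℝ :=
  (star (zeroState n) ⬝ᵥ
    (((Q.circuit θ x)ᴴ * Q.observable * Q.circuit θ x) *ᵥ zeroState n)).re

/-- The supremum norm `‖f‖_∞` of the model function over all inputs and all
`θ ∈ [0, 2π)^L`. -/
def supNorm (Q : QNN X n L m) : ℝ :=
  sSup {r : ℝ | ∃ x : X, ∃ θ : Fin L → ℝ,
    (∀ i, θ i ∈ Set.Ico 0 (2 * Real.pi)) ∧ r = |Q.model θ x|}

/-- The gradient `∇_θ f_θ(x)`: the vector of the partial derivatives in `θ`. -/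
def grad (Q : QNN X n L m) (θ : Fin L → ℝ) (x : X) : Fin L → ℝ :=
  fun i => lineDeriv ℝ (fun θ' => Q.model θ' x) θ (Pi.single i 1)

/-- The empirical neural tangent kernel. -/
def empiricalNTK (Q : QNN X n L m) (θ : Fin L → ℝ) (x x' : X) : ℝ :=
  Q.grad θ x ⬝ᵥ Q.grad θ x'

/-- The analytic neural tangent kernel: the mean of the empirical one when the entries of `θ` are
independent and uniform on `[0, 2π)`. -/
def analyticNTK (Q : QNN X n L m) (x x' : X) : ℝ :=
  ∫ θ, Q.empiricalNTK θ x x'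
    ∂(MeasureTheory.Measure.pi fun _ : Fin L =>
      ProbabilityTheory.cond (MeasureTheory.volume : MeasureTheory.Measure ℝ)
        (Set.Ico 0 (2 * Real.pi)))

/-- The finite difference `f_{θ + (π/2) eᵢ}(x) - f_{θ - (π/2) eᵢ}(x)`. -/
def shiftDiff (Q : QNN X n L m) (θ : Fin L → ℝ) (i : Fin L) (x : X) : ℝ :=
  Q.model (θ + Pi.single i (Real.pi / 2)) x - Q.model (θ - Pi.single i (Real.pi / 2)) x

/-- The estimator of the neural tangent kernel computed from the samples `S 0, …, S (N-1)`. -/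
def estimatedNTK (Q : QNN X n L m) {N : ℕ} (S : Fin N → Fin L → ℝ) (x x' : X) : ℝ :=
  1 / (4 * (N : ℝ)) * ∑ j, ∑ i, Q.shiftDiff (S j) i x * Q.shiftDiff (S j) i x'

/-- The analytic kernel on the training inputs. -/
def analyticTrain (Q : QNN X n L m) {d : ℕ} (xs : Fin d → X) : Matrix (Fin d) (Fin d) ℝ :=
  Matrix.of fun a b => Q.analyticNTK (xs a) (xs b)

/-- The estimated kernel on the training inputs. -/
def estimatedTrain (Q : QNN X n L m) {N d : ℕ} (S : Fin N → Fin L → ℝ) (xs : Fin d → X) :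
    Matrix (Fin d) (Fin d) ℝ :=
  Matrix.of fun a b => Q.estimatedNTK S (xs a) (xs b)

end QNN

/-- The grid `{0, π/2, π, 3π/2}^L`. -/
def cliffordAngles (L : ℕ) : Set (Fin L → ℝ) :=
  {θ | ∀ i, θ i ∈ ({0, Real.pi / 2, Real.pi, 3 * Real.pi / 2} : Set ℝ)}

/-- The operator norm of a real square matrix with respect to the Euclidean norm. -/
def opNorm {d : ℕ} (A : Matrix (Fin d) (Fin d) ℝ) : ℝ :=
  ‖Matrix.toEuclideanCLM (n := Fin d) (𝕜 := ℝ) A‖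

end CliffordQNN

end

/-!
A self-adjoint Pauli operator `A` is an involution, so its rotation is
`cos (φ / 2) - i sin (φ / 2) A`. With all angles but one fixed, the model function is therefore of
the form `a + b cos φ + c sin φ` (`isTrigLinear_model`). Three facts follow.

* The partial derivatives are half the finite differences (`grad_eq`), so the estimator is the
  average of the empirical kernel over the sample, and the derivatives are bounded by `‖f‖_∞`.
* In each angle the empirical kernel is a trigonometric polynomial of degree at most two. Averaging
  over the four multiples of `π / 2` integrates these exactly, and by Fubini the grid
  `{0, π/2, π, 3π/2}^L` reproduces the analytic kernel (`analyticNTK_eq`).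
* The empirical kernel matrix on the training inputs is a Gram matrix, of Frobenius norm at most
  `B = L d ‖f‖_∞²`; two such matrices have nonnegative Frobenius inner product, so their distance
  is at most `√2 B`.

The operator norm is at most the Frobenius norm, so it suffices to bound the Frobenius distance of
the sample average from its mean. By orthogonality its expectation is at most `B / √N`. Replacing
one sample moves it by at most `√2 B / N`, so by McDiarmid's inequality
(`hasSubgaussianMGF_of_bounded_differences`) it exceeds `t = u B / √N`, `u ≥ 1`, with probability at
most `exp (-(u - 1)²)`. This is at most `2 exp (-3 u² / 8)`, because `3 u² / 8 - (u - 1)² ≤ 3 / 5`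
and `3 / 5 < log 2`. For `u < 1` that bound exceeds one. Since `3 u² / 8` is the exponent claimed,
the bound holds with the factor `2` in place of `2 d` as soon as there are training inputs.
-/

open scoped Matrix

noncomputable section

namespace CliffordQNN

/-! ### Pauli rotations -/

lemma pauliMatrix_mul_self (s : Fin 4) : pauliMatrix s * pauliMatrix s = 1 := by
  fin_cases s <;> ext i j <;> fin_cases i <;> fin_cases j <;>
    simp [pauliMatrix, Matrix.mul_apply, Fin.sum_univ_two]

lemma pauliString_mul_self {n : ℕ} (s : Fin n → Fin 4) :
    pauliString s * pauliString s = 1 := by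
  ext a c
  have h : ∏ k, ∑ j, pauliMatrix (s k) (a k) j * pauliMatrix (s k) j (c k)
      = ∏ k, (1 : Matrix (Fin 2) (Fin 2) ℂ) (a k) (c k) :=
    Finset.prod_congr rfl fun k _ => by
      rw [← Matrix.mul_apply, pauliMatrix_mul_self]
  rw [Finset.prod_univ_sum, Fintype.piFinset_univ] at h
  simp only [Matrix.mul_apply, pauliString, Matrix.of_apply, ← Finset.prod_mul_distrib]
  rw [h]
  by_cases hac : a = c
  · subst hac
    simp
  · obtain ⟨k, hk⟩ := Function.ne_iff.mp hac
    rw [Matrix.one_apply_ne hac]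
    exact Finset.prod_eq_zero (Finset.mem_univ k) (Matrix.one_apply_ne hk)

/-- A self-adjoint Pauli operator is an involution: its phase cannot be `± i`, since `A * Aᴴ` has
nonnegative diagonal entries. -/
lemma mul_self_of_mem_pauliGroup {n : ℕ} {A : Op n} (hA : A ∈ pauliGroup n)
    (hA' : A.IsHermitian) : A * A = 1 := by
  obtain ⟨c, hc, s, rfl⟩ := hA
  have hsq : (c • pauliString s) * (c • pauliString s) = (c * c) • (1 : Op n) := by
    rw [smul_mul_smul_comm, pauliString_mul_self]
  have hcc : c * c = 1 ∨ c * c = -1 := by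
    rcases hc with rfl | rfl | rfl | rfl <;> simp
  rcases hcc with h | h
  · rw [hsq, h, one_smul]
  · exfalso
    rw [h] at hsq
    have h0 := congrArg (fun M : Op n => (M 0 0).re) hsq
    nth_rewrite 2 [← hA'.eq] at h0
    have hpos : 0 ≤ (((c • pauliString s) * (c • pauliString s)ᴴ : Op n) 0 0).re := by
      rw [Matrix.mul_apply, Complex.re_sum]
      refine Finset.sum_nonneg fun b _ => ?_
      rw [Matrix.conjTranspose_apply, Complex.star_def, Complex.mul_conj, Complex.ofReal_re]
      exact Complex.normSq_nonneg _
    rw [h0] at hpos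
    norm_num at hpos

/-- A rotation generated by an involution. -/
lemma rotation_eq {n : ℕ} {A : Op n} (hA : A * A = 1) (φ : ℝ) :
    rotation A φ = ((Real.cos (φ / 2) : ℝ) : ℂ) • (1 : Op n)
      + ((Real.sin (φ / 2) : ℝ) : ℂ) • (-Complex.I • A) := by
  have hpow : ∀ k, A ^ (2 * k) = 1 := fun k => by rw [pow_mul, pow_two, hA, one_pow]
  have hpow' : ∀ k, A ^ (2 * k + 1) = A := fun k => by rw [pow_succ, hpow, one_mul]
  set w : ℂ := ((φ / 2 : ℝ) : ℂ) with hw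
  have heven : HasSum (fun k : ℕ => ((2 * k).factorial⁻¹ : ℂ) • ((-(Complex.I * w)) • A) ^ (2 * k))
      (Complex.cos w • (1 : Op n)) := by
    have h := (Complex.hasSum_cos' w).smul_const (1 : Op n)
    refine h.congr_fun fun k => ?_
    rw [smul_pow, hpow, smul_smul, Even.neg_pow (even_two_mul k), mul_comm Complex.I,
      div_eq_inv_mul]
  have hodd : HasSum
      (fun k : ℕ => ((2 * k + 1).factorial⁻¹ : ℂ) • ((-(Complex.I * w)) • A) ^ (2 * k + 1))
      (Complex.sin w • (-Complex.I • A)) := by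
    have h := (Complex.hasSum_sin' w).smul_const (-Complex.I • A)
    refine h.congr_fun fun k => ?_
    rw [smul_pow, hpow', smul_smul, smul_smul, Odd.neg_pow (odd_two_mul_add_one k),
      mul_comm Complex.I]
    congr 1
    field_simp
  have hsum := heven.even_add_odd (f := fun k : ℕ =>
    ((k.factorial : ℂ)⁻¹) • ((-(Complex.I * w)) • A) ^ k) hodd
  rw [rotation, NormedSpace.exp_eq_tsum ℂ, Complex.ofReal_cos, Complex.ofReal_sin]
  exact hsum.tsum_eq

/-- Each factor enters a reversed product of a finite family linearly. -/
lemma exists_prod_reverse_ofFn_update {R : Type*} [Monoid R] {L : ℕ} (g : Fin L → R) (i : Fin L) :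
    ∃ A B : R, ∀ M : R, (List.ofFn (Function.update g i M)).reverse.prod = A * M * B := by
  induction L with
  | zero => exact i.elim0
  | succ L ih =>
    refine Fin.cases ?_ (fun i => ?_) i
    · refine ⟨(List.ofFn fun l : Fin L => g l.succ).reverse.prod, 1, fun M => ?_⟩
      simp [List.ofFn_succ]
    · obtain ⟨A, B, h⟩ := ih (fun l => g l.succ) i
      refine ⟨A, B * g 0, fun M => ?_⟩
      have h1 : (fun l : Fin L => Function.update g i.succ M l.succ)
          = Function.update (fun l => g l.succ) i M :=
        Function.update_comp_eq_of_injective g (Fin.succ_injective L) i M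
      rw [List.ofFn_succ, h1, List.reverse_cons, List.prod_append, h M]
      simp [Function.update_of_ne (Fin.succ_ne_zero i).symm, mul_assoc]

/-! ### Trigonometric polynomials of degree one -/

/-- The functions spanned by `1`, `cos` and `sin`. -/
def IsTrigLinear (f : ℝ → ℝ) : Prop :=
  ∃ a b c : ℝ, ∀ φ, f φ = a + b * Real.cos φ + c * Real.sin φ

namespace IsTrigLinear

variable {f g : ℝ → ℝ}

lemma sub (hf : IsTrigLinear f) (hg : IsTrigLinear g) : IsTrigLinear fun φ => f φ - g φ := by
  obtain ⟨a, b, c, hf⟩ := hf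
  obtain ⟨a', b', c', hg⟩ := hg
  exact ⟨a - a', b - b', c - c', fun φ => by simp only [hf, hg]; ring⟩

lemma comp_add_const (hf : IsTrigLinear f) (s : ℝ) : IsTrigLinear fun φ => f (φ + s) := by
  obtain ⟨a, b, c, hf⟩ := hf
  refine ⟨a, b * Real.cos s + c * Real.sin s, c * Real.cos s - b * Real.sin s, fun φ => ?_⟩
  simp only [hf, Real.cos_add, Real.sin_add]
  ring

lemma periodic (hf : IsTrigLinear f) : Function.Periodic f (2 * Real.pi) := by
  obtain ⟨a, b, c, hf⟩ := hf
  intro φ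
  rw [hf, hf, Real.cos_add_two_pi, Real.sin_add_two_pi]

/-- The parameter-shift rule. -/
lemma hasDerivAt (hf : IsTrigLinear f) (φ : ℝ) :
    HasDerivAt f ((f (φ + Real.pi / 2) - f (φ - Real.pi / 2)) / 2) φ := by
  obtain ⟨a, b, c, hf⟩ := hf
  have hfun : f = fun φ => a + b * Real.cos φ + c * Real.sin φ := funext hf
  have h := (((Real.hasDerivAt_cos φ).const_mul b).const_add a).add
    ((Real.hasDerivAt_sin φ).const_mul c)
  rw [hfun]
  refine h.congr_deriv ?_
  simp only [Real.cos_add_pi_div_two, Real.sin_add_pi_div_two, Real.cos_sub_pi_div_two,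
    Real.sin_sub_pi_div_two]
  ring

/-- A quadratic form in `cos (φ / 2)` and `sin (φ / 2)` is a combination of `1`, `cos φ` and
`sin φ`. -/
lemma of_half_angle {p q r : ℝ}
    (hf : ∀ φ, f φ = p * Real.cos (φ / 2) ^ 2 + q * (Real.cos (φ / 2) * Real.sin (φ / 2))
      + r * Real.sin (φ / 2) ^ 2) : IsTrigLinear f := by
  refine ⟨(p + r) / 2, (p - r) / 2, q / 2, fun φ => ?_⟩
  have h1 : Real.cos φ = 2 * Real.cos (φ / 2) ^ 2 - 1 := by
    rw [← Real.cos_two_mul]; ring_nf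
  have h2 : Real.sin φ = 2 * Real.sin (φ / 2) * Real.cos (φ / 2) := by
    rw [← Real.sin_two_mul]; ring_nf
  rw [hf, h1, h2]
  linear_combination r * Real.sin_sq_add_cos_sq (φ / 2)

end IsTrigLinear

/-! ### The model function and its gradient -/

namespace QNN

variable {X : Type*} {n L m : ℕ}

lemma rotation_gen (Q : QNN X n L m) (l : Fin L) (φ : ℝ) :
    rotation (Q.gen l) φ = ((Real.cos (φ / 2) : ℝ) : ℂ) • (1 : Op n)
      + ((Real.sin (φ / 2) : ℝ) : ℂ) • (-Complex.I • Q.gen l) :=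
  rotation_eq (mul_self_of_mem_pauliGroup (Q.gen_mem l) (Q.gen_selfAdjoint l)) φ

/-- The circuit is linear in the half-angle cosine and sine of each parameter. -/
lemma exists_circuit_update (Q : QNN X n L m) (θ : Fin L → ℝ) (i : Fin L) (x : X) :
    ∃ C D : Op n, ∀ φ, Q.circuit (Function.update θ i φ) x
      = ((Real.cos (φ / 2) : ℝ) : ℂ) • C + ((Real.sin (φ / 2) : ℝ) : ℂ) • D := by
  obtain ⟨A, B, h⟩ := exists_prod_reverse_ofFn_update
    (fun l : Fin L => Q.gate x l.succ * rotation (Q.gen l) (θ l)) i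
  refine ⟨A * Q.gate x i.succ * B * Q.gate x 0,
    A * (Q.gate x i.succ * (-Complex.I • Q.gen i)) * B * Q.gate x 0, fun φ => ?_⟩
  have hupd : (fun l : Fin L => Q.gate x l.succ * rotation (Q.gen l) (Function.update θ i φ l))
      = Function.update (fun l : Fin L => Q.gate x l.succ * rotation (Q.gen l) (θ l)) i
        (Q.gate x i.succ * rotation (Q.gen i) φ) := by
    ext1 l
    rcases eq_or_ne l i with rfl | hl
    · simp
    · simp [hl]
  rw [circuit, hupd, h, Q.rotation_gen]
  simp only [mul_add, add_mul, mul_smul_comm, smul_mul_assoc, mul_one]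

lemma isTrigLinear_model (Q : QNN X n L m) (θ : Fin L → ℝ) (i : Fin L) (x : X) :
    IsTrigLinear fun φ => Q.model (Function.update θ i φ) x := by
  obtain ⟨C, D, h⟩ := Q.exists_circuit_update θ i x
  set q : Op n → Op n → ℝ := fun A B =>
    (star (zeroState n) ⬝ᵥ ((Aᴴ * Q.observable * B) *ᵥ zeroState n)).re with hq
  refine IsTrigLinear.of_half_angle (p := q C C) (q := q C D + q D C) (r := q D D) fun φ => ?_
  simp only [model, h, hq, Matrix.conjTranspose_add, Matrix.conjTranspose_smul, Complex.star_def,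
    Complex.conj_ofReal, add_mul, mul_add, smul_mul_assoc, mul_smul_comm,
    Matrix.add_mulVec, Matrix.smul_mulVec, dotProduct_add, dotProduct_smul, Complex.add_re,
    smul_eq_mul, Complex.re_ofReal_mul]
  ring

lemma continuous_model (Q : QNN X n L m) (x : X) : Continuous fun θ => Q.model θ x := by
  have hrot : ∀ l, Continuous fun φ => rotation (Q.gen l) φ := fun l => by
    simp only [Q.rotation_gen]
    fun_prop
  have hcirc : Continuous fun θ => Q.circuit θ x := by
    have hprod : ∀ θ, Q.circuit θ x = ((List.finRange L).reverse.map fun l : Fin L =>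
        Q.gate x l.succ * rotation (Q.gen l) (θ l)).prod * Q.gate x 0 := fun θ => by
      rw [circuit, List.ofFn_eq_map, List.map_reverse]
    simp only [hprod]
    refine (continuous_list_prod _ fun l _ => ?_).mul continuous_const
    exact continuous_const.mul ((hrot l).comp (continuous_apply l))
  unfold model
  fun_prop

lemma add_single_eq_update (θ : Fin L → ℝ) (i : Fin L) (s : ℝ) :
    θ + Pi.single i s = Function.update θ i (θ i + s) := by
  ext l
  rcases eq_or_ne l i with rfl | hl <;> simp [*]

lemma sub_single_eq_update (θ : Fin L → ℝ) (i : Fin L) (s : ℝ) :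
    θ - Pi.single i s = Function.update θ i (θ i - s) := by
  ext l
  rcases eq_or_ne l i with rfl | hl <;> simp [*]

lemma grad_eq (Q : QNN X n L m) (θ : Fin L → ℝ) (x : X) (i : Fin L) :
    Q.grad θ x i = Q.shiftDiff θ i x / 2 := by
  have h := (Q.isTrigLinear_model θ i x).hasDerivAt (θ i)
  have h' : HasLineDerivAt ℝ (fun θ' => Q.model θ' x) (Q.shiftDiff θ i x / 2) θ
      (Pi.single i 1) := by
    rw [HasLineDerivAt]
    rw [← add_zero (θ i)] at h
    have h2 := h.comp_const_add (θ i) 0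
    simp only [add_zero] at h2
    convert h2 using 1
    · ext s
      rw [← Pi.single_smul, add_single_eq_update, smul_eq_mul, mul_one]
    · rw [shiftDiff, add_single_eq_update, sub_single_eq_update]
  rw [grad, h'.lineDeriv]

/-- Reducing the angles modulo `2 π` does not change the model function. -/
lemma model_toIcoMod (Q : QNN X n L m) (θ : Fin L → ℝ) (x : X) :
    Q.model (fun i => toIcoMod Real.two_pi_pos 0 (θ i)) x = Q.model θ x := by
  -- the angles with index in `s` are reduced one at a time
  have key : ∀ s : Finset (Fin L),
      Q.model (s.piecewise (fun i => toIcoMod Real.two_pi_pos 0 (θ i)) θ) x = Q.model θ x := by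
    intro s
    induction s using Finset.induction_on with
    | empty => simp
    | insert i s hi ih =>
      rw [Finset.piecewise_insert, ← ih]
      have h := (Q.isTrigLinear_model (s.piecewise (fun i => toIcoMod Real.two_pi_pos 0 (θ i)) θ)
        i x).periodic.sub_zsmul_eq (toIcoDiv Real.two_pi_pos 0 (θ i)) (x := θ i)
      have hθ : Function.update (s.piecewise (fun i => toIcoMod Real.two_pi_pos 0 (θ i)) θ) i (θ i)
          = s.piecewise (fun i => toIcoMod Real.two_pi_pos 0 (θ i)) θ := by
        conv_rhs => rw [← Function.update_eq_self i (s.piecewise _ θ)]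
        rw [Finset.piecewise_eq_of_notMem _ _ _ hi]
      simp only [hθ] at h
      exact h
  simpa using key Finset.univ

lemma abs_model_le_supNorm [Finite X] (Q : QNN X n L m) (θ : Fin L → ℝ) (x : X) :
    |Q.model θ x| ≤ Q.supNorm := by
  rw [← Q.model_toIcoMod]
  refine le_csSup ?_ ⟨x, _, fun i => ?_, rfl⟩
  · have hK : IsCompact (Set.univ.pi fun _ : Fin L => Set.Icc 0 (2 * Real.pi)) :=
      isCompact_univ_pi fun _ => isCompact_Icc
    choose b hb using fun x : X => hK.bddAbove_image (Q.continuous_model x).abs.continuousOn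
    obtain ⟨B, hB⟩ := (Set.finite_range b).bddAbove
    refine ⟨B, ?_⟩
    rintro r ⟨x, θ, hθ, rfl⟩
    exact (hb x ⟨θ, fun i _ => Set.Ico_subset_Icc_self (hθ i), rfl⟩).trans
      (hB (Set.mem_range_self x))
  · simpa using toIcoMod_mem_Ico Real.two_pi_pos 0 (θ i)

lemma abs_grad_le_supNorm [Finite X] (Q : QNN X n L m) (θ : Fin L → ℝ) (x : X) (i : Fin L) :
    |Q.grad θ x i| ≤ Q.supNorm := by
  have h1 := abs_le.1 (Q.abs_model_le_supNorm (θ + Pi.single i (Real.pi / 2)) x)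
  have h2 := abs_le.1 (Q.abs_model_le_supNorm (θ - Pi.single i (Real.pi / 2)) x)
  rw [grad_eq, shiftDiff, abs_le]
  constructor <;> linarith [h1.1, h1.2, h2.1, h2.2]

lemma continuous_grad (Q : QNN X n L m) (x : X) (i : Fin L) :
    Continuous fun θ => Q.grad θ x i := by
  simp only [grad_eq, shiftDiff]
  have h := Q.continuous_model x
  exact ((h.comp (continuous_id.add continuous_const)).sub
    (h.comp (continuous_id.sub continuous_const))).div_const 2

lemma continuous_empiricalNTK (Q : QNN X n L m) (x x' : X) :
    Continuous fun θ => Q.empiricalNTK θ x x' :=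
  continuous_finsetSum Finset.univ fun i _ => (Q.continuous_grad x i).mul (Q.continuous_grad x' i)

lemma isTrigLinear_grad (Q : QNN X n L m) (θ : Fin L → ℝ) (l : Fin L) (x : X) (i : Fin L) :
    IsTrigLinear fun φ => Q.grad (Function.update θ l φ) x i := by
  -- a shift in the coordinate `l` itself translates `φ`, and any other shift only moves `θ`
  have hshift : ∀ s, IsTrigLinear fun φ => Q.model (Function.update θ l φ + Pi.single i s) x := by
    intro s
    rcases eq_or_ne l i with rfl | hl
    · have h := (Q.isTrigLinear_model θ l x).comp_add_const s
      convert h using 3 with φ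
      rw [add_single_eq_update, Function.update_self, Function.update_idem]
    · convert Q.isTrigLinear_model (θ + Pi.single i s) l x using 3 with φ
      ext k
      rcases eq_or_ne k l with rfl | hk
      · simp [hl]
      · simp [hk]
  obtain ⟨a, b, c, h⟩ := (hshift (Real.pi / 2)).sub (hshift (-(Real.pi / 2)))
  refine ⟨a / 2, b / 2, c / 2, fun φ => ?_⟩
  have h1 := h φ
  simp only [Pi.single_neg, ← sub_eq_add_neg] at h1
  simp only [grad_eq, shiftDiff, h1]
  ring

lemma estimatedNTK_eq (Q : QNN X n L m) {N : ℕ} (S : Fin N → Fin L → ℝ) (x x' : X) :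
    Q.estimatedNTK S x x' = (N : ℝ)⁻¹ * ∑ j, Q.empiricalNTK (S j) x x' := by
  rw [estimatedNTK, one_div, mul_inv, mul_comm (4⁻¹ : ℝ), mul_assoc, Finset.mul_sum]
  congr 1
  refine Finset.sum_congr rfl fun j _ => ?_
  simp only [empiricalNTK, dotProduct, grad_eq, Finset.mul_sum]
  exact Finset.sum_congr rfl fun i _ => by ring

end QNN

open MeasureTheory ProbabilityTheory

/-! ### Powers of a probability measure -/

section Pi

variable {α : Type*} [MeasurableSpace α] {N : ℕ}

lemma measurePreserving_cons (μ : Measure α) [SigmaFinite μ] :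
    MeasurePreserving (fun p : α × (Fin N → α) => (Fin.cons p.1 p.2 : Fin (N + 1) → α))
      (μ.prod (Measure.pi fun _ => μ)) (Measure.pi fun _ => μ) := by
  have h := (measurePreserving_piFinSuccAbove (fun _ : Fin (N + 1) => μ) 0).symm
  convert h using 1
  ext p : 1
  simp [MeasurableEquiv.piFinSuccAbove]
  rfl

lemma measurable_cons : Measurable
    (fun p : α × (Fin N → α) => (Fin.cons p.1 p.2 : Fin (N + 1) → α)) := by
  refine measurable_pi_iff.2 fun i => ?_
  refine Fin.cases ?_ (fun i => ?_) i
  · simpa using measurable_fst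
  · simpa using! (measurable_pi_apply i).comp measurable_snd

variable (μ ν : Measure α) [IsProbabilityMeasure μ] [IsProbabilityMeasure ν]
  {f : (Fin (N + 1) → α) → ℝ}

lemma integrable_of_abs_le {β : Type*} [MeasurableSpace β] (κ : Measure β) [IsFiniteMeasure κ]
    {f : β → ℝ} (hf : Measurable f) {C : ℝ} (hC : ∀ x, |f x| ≤ C) : Integrable f κ :=
  Integrable.of_bound hf.aestronglyMeasurable C (Filter.Eventually.of_forall hC)

lemma integral_pi_succ (hf : Measurable f) {C : ℝ} (hC : ∀ x, |f x| ≤ C) :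
    ∫ x, f x ∂(Measure.pi fun _ => μ)
      = ∫ a, ∫ x, f (Fin.cons a x) ∂(Measure.pi fun _ => μ) ∂μ := by
  rw [← (measurePreserving_cons μ).map_eq, integral_map measurable_cons.aemeasurable
    hf.aestronglyMeasurable]
  exact integral_prod _ (integrable_of_abs_le _ (hf.comp measurable_cons) fun _ => hC _)

lemma integral_pi_succ_symm (hf : Measurable f) {C : ℝ} (hC : ∀ x, |f x| ≤ C) :
    ∫ x, f x ∂(Measure.pi fun _ => μ)
      = ∫ x, ∫ a, f (Fin.cons a x) ∂μ ∂(Measure.pi fun _ => μ) := by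
  rw [← (measurePreserving_cons μ).map_eq, integral_map measurable_cons.aemeasurable
    hf.aestronglyMeasurable]
  exact integral_prod_symm _ (integrable_of_abs_le _ (hf.comp measurable_cons) fun _ => hC _)

/-- If two probability measures give every one-dimensional section of `f` the same integral, then
their powers give `f` the same integral. -/
lemma integral_pi_eq_of_forall_update {N : ℕ} {f : (Fin N → α) → ℝ} (hf : Measurable f) {C : ℝ}
    (hC : ∀ x, |f x| ≤ C)
    (h : ∀ x i, ∫ a, f (Function.update x i a) ∂μ = ∫ a, f (Function.update x i a) ∂ν) :
    ∫ x, f x ∂(Measure.pi fun _ => μ) = ∫ x, f x ∂(Measure.pi fun _ => ν) := by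
  induction N with
  | zero => rw [Measure.pi_of_empty (fun _ : Fin 0 => μ), Measure.pi_of_empty (fun _ : Fin 0 => ν)]
  | succ N ih =>
    have hcons : ∀ a : α, Measurable fun x : Fin N → α => f (Fin.cons a x) := fun a =>
      hf.comp (measurable_cons.comp measurable_prodMk_left)
    calc ∫ x, f x ∂(Measure.pi fun _ => μ)
        = ∫ a, ∫ x, f (Fin.cons a x) ∂(Measure.pi fun _ => μ) ∂μ := integral_pi_succ μ hf hC
      _ = ∫ a, ∫ x, f (Fin.cons a x) ∂(Measure.pi fun _ => ν) ∂μ := by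
          congr 1 with a
          refine ih (hcons a) (fun _ => hC _) fun x i => ?_
          simpa only [Fin.cons_update] using h (Fin.cons a x) i.succ
      _ = ∫ x, ∫ a, f (Fin.cons a x) ∂μ ∂(Measure.pi fun _ => ν) :=
          integral_integral_swap
            (integrable_of_abs_le _ (hf.comp measurable_cons) fun _ => hC _)
      _ = ∫ x, ∫ a, f (Fin.cons a x) ∂ν ∂(Measure.pi fun _ => ν) := by
          congr 1 with x
          obtain ⟨a₀⟩ := nonempty_of_isProbabilityMeasure μ
          simpa only [Fin.update_cons_zero] using h (Fin.cons a₀ x) 0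
      _ = ∫ x, f x ∂(Measure.pi fun _ => ν) := (integral_pi_succ_symm ν hf hC).symm

/-- The uniform measure on a finite box is the product of the uniform measures on its sides. In
`ProbabilityTheory.uniformOn_pi` the ambient type itself is finite. -/
lemma uniformOn_univ_pi {ι : Type*} [Fintype ι] [MeasurableSingletonClass α] {s : Set α}
    (hs : s.Finite) (hs' : s.Nonempty) :
    uniformOn (Set.univ.pi fun _ : ι => s) = Measure.pi fun _ => uniformOn s := by
  classical
  have := isProbabilityMeasure_uniformOn hs hs'
  refine (Measure.pi_eq fun t ht => ?_).symm
  lift s to Finset α using hs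
  have hpi : ∀ u : ι → Finset α, Measure.count (Set.univ.pi fun i => (u i : Set α))
      = ∏ i, ((u i).card : ENNReal) := fun u => by
    rw [← Fintype.coe_piFinset, Measure.count_apply_finset, Fintype.card_piFinset]
    push_cast
    rfl
  have hsm : MeasurableSet (Set.univ.pi fun _ : ι => (s : Set α)) :=
    MeasurableSet.univ_pi fun _ => s.measurableSet
  have hst : ∀ i, (s : Set α) ∩ t i = ((s.filter (· ∈ t i) : Finset α) : Set α) := fun i => by
    ext; simp
  simp only [uniformOn, cond_apply hsm, cond_apply s.measurableSet, ← Set.pi_inter_distrib, hst,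
    hpi, Measure.count_apply_finset]
  rw [Finset.prod_mul_distrib, ENNReal.prod_inv_distrib]
  intro i _ j _ _
  exact Or.inr (by simp)

end Pi

/-! ### Quadrature on the grid of Clifford angles -/

/-- The trigonometric polynomials of degree at most two. -/
def IsTrigQuadratic (f : ℝ → ℝ) : Prop :=
  ∃ a b c d e : ℝ, ∀ φ, f φ = a + b * Real.cos φ + c * Real.sin φ + d * Real.cos φ ^ 2
    + e * (Real.sin φ * Real.cos φ)

lemma IsTrigLinear.mul {f g : ℝ → ℝ} (hf : IsTrigLinear f) (hg : IsTrigLinear g) :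
    IsTrigQuadratic fun φ => f φ * g φ := by
  obtain ⟨a, b, c, hf⟩ := hf
  obtain ⟨a', b', c', hg⟩ := hg
  refine ⟨a * a' + c * c', a * b' + b * a', a * c' + c * a', b * b' - c * c', b * c' + c * b',
    fun φ => ?_⟩
  simp only [hf, hg]
  linear_combination c * c' * Real.sin_sq_add_cos_sq φ

lemma IsTrigQuadratic.sum {ι : Type*} (s : Finset ι) {f : ι → ℝ → ℝ}
    (hf : ∀ i, IsTrigQuadratic (f i)) : IsTrigQuadratic fun φ => ∑ i ∈ s, f i φ := by
  choose a b c d e hf using hf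
  refine ⟨∑ i ∈ s, a i, ∑ i ∈ s, b i, ∑ i ∈ s, c i, ∑ i ∈ s, d i, ∑ i ∈ s, e i, fun φ => ?_⟩
  simp only [hf, Finset.sum_add_distrib, Finset.sum_mul]

/-- The uniform probability measure on `[0, 2π)`. -/
abbrev circleMeasure : Measure ℝ := cond volume (Set.Ico 0 (2 * Real.pi))

/-- The uniform probability measure on the four multiples of `π / 2` in `[0, 2π)`. -/
abbrev gridMeasure : Measure ℝ :=
  uniformOn ({0, Real.pi / 2, Real.pi, 3 * Real.pi / 2} : Set ℝ)

instance : IsProbabilityMeasure circleMeasure :=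
  cond_isProbabilityMeasure_of_finite (by simp [Real.pi_pos])
    (by rw [Real.volume_Ico]; exact ENNReal.ofReal_ne_top)

instance : IsProbabilityMeasure gridMeasure :=
  isProbabilityMeasure_uniformOn (by simp) (by simp)

lemma uniformOn_cliffordAngles (L : ℕ) :
    uniformOn (cliffordAngles L) = Measure.pi fun _ => gridMeasure := by
  rw [← uniformOn_univ_pi (by simp) (by simp)]
  congr 1
  ext θ
  simp [cliffordAngles]

lemma integral_gridMeasure (f : ℝ → ℝ) :
    ∫ φ, f φ ∂gridMeasure
      = (f 0 + f (Real.pi / 2) + f Real.pi + f (3 * Real.pi / 2)) / 4 := by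
  have hpi := Real.pi_pos
  set s : Finset ℝ := {0, Real.pi / 2, Real.pi, 3 * Real.pi / 2} with hs
  have h1 : (0 : ℝ) ∉ ({Real.pi / 2, Real.pi, 3 * Real.pi / 2} : Finset ℝ) := by
    simp only [Finset.mem_insert, Finset.mem_singleton, not_or]
    refine ⟨?_, ?_, ?_⟩ <;> intro h <;> linarith
  have h2 : Real.pi / 2 ∉ ({Real.pi, 3 * Real.pi / 2} : Finset ℝ) := by
    simp only [Finset.mem_insert, Finset.mem_singleton, not_or]
    refine ⟨?_, ?_⟩ <;> intro h <;> linarith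
  have h3 : Real.pi ∉ ({3 * Real.pi / 2} : Finset ℝ) := by
    simp only [Finset.mem_singleton]
    intro h; linarith
  have hcard : s.card = 4 := by
    rw [hs, Finset.card_insert_of_notMem h1, Finset.card_insert_of_notMem h2,
      Finset.card_insert_of_notMem h3, Finset.card_singleton]
  have hset : ({0, Real.pi / 2, Real.pi, 3 * Real.pi / 2} : Set ℝ) = (s : Set ℝ) := by
    simp [hs]
  -- counting measure on `ℝ` is infinite, so integrability is obtained for its restriction
  have hfin : IsFiniteMeasure (Measure.count.restrict (s : Set ℝ)) :=
    ⟨by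
      rw [Measure.restrict_apply_univ, Measure.count_apply_finset]
      exact ENNReal.natCast_lt_top _⟩
  have hint : IntegrableOn f (s : Set ℝ) Measure.count := by
    have h := IntegrableOn.finset (μ := Measure.count.restrict (s : Set ℝ)) (s := s) (f := f)
    rwa [IntegrableOn, Measure.restrict_restrict s.measurableSet, Set.inter_self] at h
  rw [gridMeasure, hset, uniformOn, ProbabilityTheory.cond, integral_smul_measure,
    setIntegral_finset _ hint,
    Measure.count_apply_finset, hcard]
  rw [hs, Finset.sum_insert h1, Finset.sum_insert h2, Finset.sum_insert h3, Finset.sum_singleton]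
  simp [Measure.real]
  ring

lemma integral_circleMeasure (f : ℝ → ℝ) :
    ∫ φ, f φ ∂circleMeasure = (2 * Real.pi)⁻¹ * ∫ φ in (0)..(2 * Real.pi), f φ := by
  rw [circleMeasure, ProbabilityTheory.cond, integral_smul_measure,
    intervalIntegral.integral_of_le Real.two_pi_pos.le, integral_Ico_eq_integral_Ioc]
  simp [Real.pi_pos.le]

/-- The four grid points form a quadrature rule that is exact in degree two. -/
lemma IsTrigQuadratic.integral_circleMeasure_eq {f : ℝ → ℝ} (hf : IsTrigQuadratic f) :
    ∫ φ, f φ ∂circleMeasure = ∫ φ, f φ ∂gridMeasure := by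
  obtain ⟨a, b, c, d, e, hf⟩ := hf
  have hpi := Real.pi_pos
  have hint : ∫ φ in (0)..(2 * Real.pi), f φ = 2 * Real.pi * a + Real.pi * d := by
    simp only [hf]
    have i1 : ∀ g : ℝ → ℝ, Continuous g → IntervalIntegrable g volume 0 (2 * Real.pi) :=
      fun g hg => hg.intervalIntegrable _ _
    rw [intervalIntegral.integral_add (i1 _ (by fun_prop)) (i1 _ (by fun_prop)),
      intervalIntegral.integral_add (i1 _ (by fun_prop)) (i1 _ (by fun_prop)),
      intervalIntegral.integral_add (i1 _ (by fun_prop)) (i1 _ (by fun_prop)),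
      intervalIntegral.integral_add (i1 _ (by fun_prop)) (i1 _ (by fun_prop))]
    simp only [intervalIntegral.integral_const_mul, integral_cos_sq, integral_cos, integral_sin,
      integral_sin_mul_cos₁, intervalIntegral.integral_const]
    simp
    ring
  have h32 : 3 * Real.pi / 2 = Real.pi / 2 + Real.pi := by ring
  rw [integral_circleMeasure, hint, integral_gridMeasure]
  simp only [hf, h32, Real.cos_add_pi, Real.sin_add_pi]
  simp
  field_simp
  ring

namespace QNN

variable {X : Type*} [Finite X] {n L m : ℕ}

lemma abs_empiricalNTK_le (Q : QNN X n L m) (θ : Fin L → ℝ) (x x' : X) :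
    |Q.empiricalNTK θ x x'| ≤ L * Q.supNorm ^ 2 := by
  have habs : |Q.empiricalNTK θ x x'| ≤ ∑ i, |Q.grad θ x i * Q.grad θ x' i| :=
    Finset.abs_sum_le_sum_abs (fun i => Q.grad θ x i * Q.grad θ x' i) Finset.univ
  refine habs.trans ?_
  calc ∑ i, |Q.grad θ x i * Q.grad θ x' i| ≤ ∑ _i : Fin L, Q.supNorm ^ 2 := by
        refine Finset.sum_le_sum fun i _ => ?_
        rw [abs_mul, sq]
        exact mul_le_mul (Q.abs_grad_le_supNorm θ x i) (Q.abs_grad_le_supNorm θ x' i)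
          (abs_nonneg _) ((abs_nonneg _).trans (Q.abs_grad_le_supNorm θ x i))
    _ = L * Q.supNorm ^ 2 := by simp

/-- The Clifford angles reproduce the analytic kernel: the estimator is unbiased. -/
lemma analyticNTK_eq (Q : QNN X n L m) (x x' : X) :
    Q.analyticNTK x x' = ∫ θ, Q.empiricalNTK θ x x' ∂(uniformOn (cliffordAngles L)) := by
  rw [uniformOn_cliffordAngles]
  refine integral_pi_eq_of_forall_update circleMeasure gridMeasure
    (Q.continuous_empiricalNTK x x').measurable (fun θ => Q.abs_empiricalNTK_le θ x x')
    fun θ l => IsTrigQuadratic.integral_circleMeasure_eq ?_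
  exact IsTrigQuadratic.sum Finset.univ fun i =>
    (Q.isTrigLinear_grad θ l x i).mul (Q.isTrigLinear_grad θ l x' i)

end QNN

/-! ### The bounded differences inequality -/

/-- **McDiarmid's bounded differences inequality** for independent, identically distributed
variables, in sub-Gaussian form. -/
theorem hasSubgaussianMGF_of_bounded_differences {α : Type*} [MeasurableSpace α] (μ : Measure α)
    [IsProbabilityMeasure μ] {N : ℕ} {g : (Fin N → α) → ℝ} (hg : Measurable g) {C : ℝ}
    (hC : ∀ x, |g x| ≤ C) {c : NNReal}
    (hc : ∀ x i a b, g (Function.update x i a) ≤ g (Function.update x i b) + c) :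
    HasSubgaussianMGF (fun x => g x - ∫ y, g y ∂(Measure.pi fun _ => μ)) (N * (c / 2) ^ 2)
      (Measure.pi fun _ : Fin N => μ) := by
  -- all exponentials below are bounded, hence integrable
  have hC0 : ∀ {k : ℕ} {h : (Fin k → α) → ℝ}, (∀ x, |h x| ≤ C) → ∀ (s : ℝ) {r : ℝ}, |r| ≤ C →
      ∀ x, |Real.exp (s * (h x - r))| ≤ Real.exp (|s| * (2 * C)) := by
    intro k h hh s r hr x
    rw [Real.abs_exp, Real.exp_le_exp]
    refine (le_abs_self _).trans ?_
    rw [abs_mul]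
    refine mul_le_mul_of_nonneg_left ?_ (abs_nonneg s)
    have h1 := abs_le.1 (hh x)
    have h2 := abs_le.1 hr
    rw [abs_le]
    constructor <;> linarith [h1.1, h1.2, h2.1, h2.2]
  have hmean : ∀ {β : Type _} [MeasurableSpace β] (κ : Measure β) [IsProbabilityMeasure κ]
      {h : β → ℝ}, (∀ x, |h x| ≤ C) → |∫ y, h y ∂κ| ≤ C := by
    intro β _ κ _ h hh
    simpa using norm_integral_le_of_norm_le_const (μ := κ) (f := h) (C := C)
      (Filter.Eventually.of_forall hh)
  have hexpm : ∀ {k : ℕ} {h : (Fin k → α) → ℝ}, Measurable h → ∀ (s r : ℝ),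
      Measurable fun x => Real.exp (s * (h x - r)) := fun hh s r => by fun_prop
  refine ⟨fun s => integrable_of_abs_le _ (hexpm hg s _) (hC0 hC s (hmean _ hC)), fun s => ?_⟩
  induction N with
  | zero =>
    simp [mgf, Measure.pi_of_empty (fun _ : Fin 0 => μ)]
  | succ N ih =>
    have hgc : Measurable fun p : α × (Fin N → α) => g (Fin.cons p.1 p.2) :=
      hg.comp measurable_cons
    -- average out the first variable
    set h : (Fin N → α) → ℝ := fun x => ∫ a, g (Fin.cons a x) ∂μ with hh
    have hhm : Measurable h := hgc.stronglyMeasurable.integral_prod_left'.measurable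
    have hhC : ∀ x, |h x| ≤ C := fun x => hmean μ fun a => hC _
    have hcons : ∀ x a b, g (Fin.cons a x) ≤ g (Fin.cons b x) + c := fun x a b => by
      simpa only [Fin.update_cons_zero] using hc (Fin.cons a x) 0 a b
    have hhc : ∀ x i a b, h (Function.update x i a) ≤ h (Function.update x i b) + c := by
      intro x i a b
      have hint : ∀ y : Fin N → α, Integrable (fun z => g (Fin.cons z y)) μ := fun y =>
        integrable_of_abs_le μ (hgc.comp measurable_prodMk_right) fun z => hC _
      have h1 : ∫ z, (g (Fin.cons z (Function.update x i b)) + c) ∂μ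
          = h (Function.update x i b) + c := by
        rw [integral_add (hint _) (integrable_const _)]
        simp [hh]
      rw [← h1]
      refine integral_mono (hint _) ((hint _).add (integrable_const _)) fun z => ?_
      simpa only [Fin.cons_update] using hc (Fin.cons z x) i.succ a b
    have hgh : ∫ y, g y ∂(Measure.pi fun _ => μ) = ∫ y, h y ∂(Measure.pi fun _ => μ) :=
      integral_pi_succ_symm μ hg hC
    have ih' := ih hhm hhC hhc
    set r := ∫ y, h y ∂(Measure.pi fun _ => μ) with hr
    have hrC : |r| ≤ C := hmean _ hhC
    -- Hoeffding's lemma in the first variable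
    have hinner : ∀ x, ∫ a, Real.exp (s * (g (Fin.cons a x) - r)) ∂μ
        ≤ Real.exp ((c / 2 : ℝ) ^ 2 * s ^ 2 / 2) * Real.exp (s * (h x - r)) := by
      intro x
      have hbdd : BddBelow (Set.range fun a => g (Fin.cons a x)) := by
        refine ⟨-C, ?_⟩
        rintro _ ⟨a, rfl⟩
        exact (abs_le.1 (hC _)).1
      have := nonempty_of_isProbabilityMeasure μ
      have hH := (hasSubgaussianMGF_of_mem_Icc (μ := μ) (X := fun a => g (Fin.cons a x))
        (a := ⨅ a, g (Fin.cons a x)) (b := (⨅ a, g (Fin.cons a x)) + c)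
        (hgc.comp measurable_prodMk_right).aemeasurable
        (Filter.Eventually.of_forall fun a => ⟨ciInf_le hbdd a, by
          rw [← sub_le_iff_le_add]
          exact le_ciInf fun b => sub_le_iff_le_add.2 (hcons x a b)⟩)).mgf_le s
      simp only [add_sub_cancel_left, mgf] at hH
      have hsplit : ∀ a, Real.exp (s * (g (Fin.cons a x) - r))
          = Real.exp (s * (g (Fin.cons a x) - h x)) * Real.exp (s * (h x - r)) := fun a => by
        rw [← Real.exp_add]; ring_nf
      simp only [hsplit]
      rw [integral_mul_const]
      refine mul_le_mul_of_nonneg_right ?_ (Real.exp_pos _).le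
      simpa using hH
    rw [hgh, mgf, integral_pi_succ_symm μ (hexpm hg s r) (hC0 hC s hrC)]
    calc ∫ x, ∫ a, Real.exp (s * (g (Fin.cons a x) - r)) ∂μ ∂(Measure.pi fun _ => μ)
        ≤ ∫ x, Real.exp ((c / 2 : ℝ) ^ 2 * s ^ 2 / 2) * Real.exp (s * (h x - r))
            ∂(Measure.pi fun _ : Fin N => μ) := by
          refine integral_mono_of_nonneg (Filter.Eventually.of_forall fun x =>
            integral_nonneg fun a => (Real.exp_pos _).le) ?_ (Filter.Eventually.of_forall hinner)
          exact (integrable_of_abs_le _ (hexpm hhm s r) (hC0 hhC s hrC)).const_mul _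
      _ ≤ Real.exp ((c / 2 : ℝ) ^ 2 * s ^ 2 / 2)
            * Real.exp (((N * (c / 2) ^ 2 : NNReal) : ℝ) * s ^ 2 / 2) := by
          rw [integral_const_mul]
          exact mul_le_mul_of_nonneg_left ih' (Real.exp_pos _).le
      _ = _ := by
          rw [← Real.exp_add]
          congr 1
          push_cast
          ring

/-! ### Concentration of empirical means -/

section Average

variable {Θ ι : Type*} [Fintype ι] {N : ℕ}

/-- The distance from the empirical mean of `V` over a sample to the vector `k`. -/
def averageDist (V : Θ → EuclideanSpace ℝ ι) (k : EuclideanSpace ℝ ι) (x : Fin N → Θ) : ℝ :=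
  ‖(N : ℝ)⁻¹ • ∑ j, V (x j) - k‖

variable {V : Θ → EuclideanSpace ℝ ι} {k : EuclideanSpace ℝ ι} {B : ℝ}

/-- Nonnegative inner products improve the trivial bound `2 * B` to `√2 * B`; with the
trivial bound, McDiarmid's inequality would not give the constant `3 / 8` when `d` is one or two. -/
lemma norm_sub_le_of_inner_nonneg (hB : ∀ θ, ‖V θ‖ ≤ B) (hV : ∀ θ θ', 0 ≤ inner ℝ (V θ) (V θ'))
    (θ θ' : Θ) : ‖V θ - V θ'‖ ≤ √2 * B := by
  have hB0 : 0 ≤ B := (norm_nonneg _).trans (hB θ)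
  refine le_of_pow_le_pow_left₀ two_ne_zero (by positivity) ?_
  rw [norm_sub_sq_real, mul_pow, Real.sq_sqrt zero_le_two]
  have h1 := pow_le_pow_left₀ (norm_nonneg _) (hB θ) 2
  have h2 := pow_le_pow_left₀ (norm_nonneg _) (hB θ') 2
  linarith [hV θ θ']

lemma averageDist_update_le (hB : ∀ θ, ‖V θ‖ ≤ B) (hV : ∀ θ θ', 0 ≤ inner ℝ (V θ) (V θ'))
    (x : Fin N → Θ) (i : Fin N) (θ θ' : Θ) :
    averageDist V k (Function.update x i θ)
      ≤ averageDist V k (Function.update x i θ') + √2 * B / N := by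
  have hdiff : (N : ℝ)⁻¹ • ∑ j, V (Function.update x i θ j) - k
      = ((N : ℝ)⁻¹ • ∑ j, V (Function.update x i θ' j) - k) + (N : ℝ)⁻¹ • (V θ - V θ') := by
    have hsum : ∀ a, ∑ j, V (Function.update x i a j)
        = V a + ∑ j ∈ Finset.univ.erase i, V (x j) := fun a => by
      rw [← Finset.add_sum_erase _ _ (Finset.mem_univ i), Function.update_self]
      congr 1
      refine Finset.sum_congr rfl fun j hj => ?_
      rw [Function.update_of_ne (Finset.ne_of_mem_erase hj)]
    rw [hsum, hsum]
    module
  rw [averageDist, hdiff]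
  refine (norm_add_le _ _).trans (add_le_add_right ?_ _)
  rw [norm_smul, norm_inv, RCLike.norm_natCast, inv_mul_eq_div]
  exact div_le_div_of_nonneg_right (norm_sub_le_of_inner_nonneg hB hV θ θ') (Nat.cast_nonneg N)

lemma averageDist_le (hB : ∀ θ, ‖V θ‖ ≤ B) (hN : 0 < N) (x : Fin N → Θ) :
    |averageDist V k x| ≤ B + ‖k‖ := by
  have hN' : (0 : ℝ) < N := Nat.cast_pos.2 hN
  rw [averageDist, abs_norm]
  refine (norm_sub_le _ _).trans (add_le_add_left ?_ _)
  rw [norm_smul, norm_inv, RCLike.norm_natCast, inv_mul_le_iff₀ hN']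
  refine (norm_sum_le _ _).trans ?_
  simpa using Finset.sum_le_sum fun j (_ : j ∈ Finset.univ) => hB (x j)

variable [MeasurableSpace Θ] (ν : Measure Θ) [IsProbabilityMeasure ν]

lemma measurable_averageDist (hVm : ∀ p, Measurable fun θ => V θ p) :
    Measurable (averageDist (N := N) V k) := by
  have hVm' : Measurable V := by
    have h : Measurable fun θ => WithLp.toLp 2 fun p => V θ p :=
      (PiLp.continuous_toLp 2 _).measurable.comp (measurable_pi_iff.2 hVm)
    exact h
  unfold averageDist
  fun_prop

/-- The mean square distance from the empirical mean to the true mean decays like `1 / N`. -/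
lemma integral_averageDist_sq_le (hVm : ∀ p, Measurable fun θ => V θ p) (hB : ∀ θ, ‖V θ‖ ≤ B)
    (hk : ∀ p, k p = ∫ θ, V θ p ∂ν) (hN : 0 < N) :
    ∫ x, averageDist V k x ^ 2 ∂(Measure.pi fun _ : Fin N => ν) ≤ B ^ 2 / N := by
  have hN' : (N : ℝ) ≠ 0 := Nat.cast_ne_zero.2 hN.ne'
  have hVB : ∀ p θ, |V θ p| ≤ B := fun p θ => (PiLp.norm_apply_le (V θ) p).trans (hB θ)
  have hmem : ∀ p, MemLp (fun θ => V θ p) 2 ν := fun p =>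
    MemLp.of_bound (hVm p).aestronglyMeasurable B (Filter.Eventually.of_forall (hVB p))
  have hint : ∀ p, Integrable (fun θ => V θ p) ν := fun p => (hmem p).integrable one_le_two
  set A : ι → (Fin N → Θ) → ℝ := fun p x => (N : ℝ)⁻¹ * ∑ j, V (x j) p with hA
  have hAmem : ∀ p, MemLp (A p) 2 (Measure.pi fun _ : Fin N => ν) := fun p =>
    (memLp_finsetSum Finset.univ fun j _ =>
      (hmem p).comp_measurePreserving (measurePreserving_eval (fun _ : Fin N => ν) j)).const_mul _
  have hAmean : ∀ p, ∫ x, A p x ∂(Measure.pi fun _ : Fin N => ν) = k p := fun p => by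
    have h1 : ∀ j : Fin N, ∫ x : Fin N → Θ, V (x j) p ∂(Measure.pi fun _ : Fin N => ν) = k p :=
      fun j => by
        rw [hk p]
        exact integral_comp_eval (μ := fun _ : Fin N => ν) (f := fun θ => V θ p)
          (hVm p).aestronglyMeasurable
    rw [hA, integral_const_mul, integral_finsetSum _ fun j _ =>
      integrable_comp_eval (μ := fun _ : Fin N => ν) (i := j) (hint p)]
    simp only [h1, Finset.sum_const, Finset.card_univ, Fintype.card_fin, nsmul_eq_mul]
    field_simp
  have hAvar : ∀ p, Var[A p; Measure.pi fun _ : Fin N => ν] = (N : ℝ)⁻¹ * Var[fun θ => V θ p; ν] :=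
    fun p => by
      have h := variance_sum_pi (μ := fun _ : Fin N => ν) (X := fun _ θ => V θ p) fun _ => hmem p
      have hfun : (∑ i, fun ω : Fin N → Θ => V (ω i) p) = fun ω => ∑ i, V (ω i) p := by
        ext ω; simp
      rw [hfun] at h
      rw [hA, variance_const_mul, h]
      simp only [Finset.sum_const, Finset.card_univ, Fintype.card_fin, nsmul_eq_mul]
      field_simp
  have hsq : ∀ x, averageDist V k x ^ 2 = ∑ p, (A p x - k p) ^ 2 := fun x => by
    rw [averageDist, EuclideanSpace.norm_sq_eq]
    refine Finset.sum_congr rfl fun p _ => ?_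
    simp [hA]
  simp only [hsq]
  rw [integral_finsetSum _ fun p _ =>
    (show Integrable (fun x => (A p x - k p) ^ 2) (Measure.pi fun _ : Fin N => ν) from
      ((hAmem p).sub (memLp_const (k p))).integrable_sq)]
  have hterm : ∀ p, ∫ x, (A p x - k p) ^ 2 ∂(Measure.pi fun _ : Fin N => ν)
      ≤ (N : ℝ)⁻¹ * ∫ θ, V θ p ^ 2 ∂ν := fun p => by
    have h := variance_eq_integral (hAmem p).aestronglyMeasurable.aemeasurable
    rw [hAmean, hAvar] at h
    rw [← h]
    refine mul_le_mul_of_nonneg_left ?_ (by positivity)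
    exact variance_le_expectation_sq (hmem p).aestronglyMeasurable
  refine (Finset.sum_le_sum fun p _ => hterm p).trans ?_
  rw [← Finset.mul_sum, ← integral_finsetSum _ fun p _ => (hmem p).integrable_sq, inv_mul_eq_div]
  refine div_le_div_of_nonneg_right ?_ (Nat.cast_nonneg N)
  have hle : ∀ θ, ∑ p, V θ p ^ 2 ≤ B ^ 2 := fun θ => by
    rw [← EuclideanSpace.real_norm_sq_eq]
    exact pow_le_pow_left₀ (norm_nonneg _) (hB θ) 2
  calc ∫ θ, ∑ p, V θ p ^ 2 ∂ν ≤ ∫ _, B ^ 2 ∂ν :=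
        integral_mono (integrable_finsetSum _ fun p _ => (hmem p).integrable_sq)
          (integrable_const _) hle
    _ = B ^ 2 := by simp

lemma integral_averageDist_le (hVm : ∀ p, Measurable fun θ => V θ p) (hB : ∀ θ, ‖V θ‖ ≤ B)
    (hB0 : 0 ≤ B) (hk : ∀ p, k p = ∫ θ, V θ p ∂ν) (hN : 0 < N) :
    ∫ x, averageDist V k x ∂(Measure.pi fun _ : Fin N => ν) ≤ B / √N := by
  have hmem : MemLp (averageDist V k) 2 (Measure.pi fun _ : Fin N => ν) :=
    MemLp.of_bound (measurable_averageDist hVm).aestronglyMeasurable (B + ‖k‖)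
      (Filter.Eventually.of_forall (averageDist_le hB hN))
  have h1 := variance_nonneg (averageDist V k) (Measure.pi fun _ : Fin N => ν)
  rw [variance_eq_sub hmem] at h1
  have h2 := integral_averageDist_sq_le ν hVm hB hk hN
  refine le_of_pow_le_pow_left₀ two_ne_zero (by positivity) ?_
  rw [div_pow, Real.sq_sqrt (Nat.cast_nonneg N)]
  simp only [Pi.pow_apply] at h1
  linarith

/-- The scalar inequality behind the constant `3 / 8`: the parabola `3 u² / 8 - (u - 1)²` has
maximum `3 / 5`, which is less than `log 2`. -/
lemma exp_neg_sub_one_sq_le (u : ℝ) :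
    Real.exp (-(u - 1) ^ 2) ≤ 2 * Real.exp (-(3 / 8 * u ^ 2)) := by
  calc Real.exp (-(u - 1) ^ 2) ≤ Real.exp (Real.log 2 + -(3 / 8 * u ^ 2)) := Real.exp_le_exp.2 ?_
    _ = 2 * Real.exp (-(3 / 8 * u ^ 2)) := by rw [Real.exp_add, Real.exp_log two_pos]
  nlinarith [Real.log_two_gt_d9, sq_nonneg (u - 8 / 5)]

/-- Dimension-free concentration of the empirical mean of bounded vectors with pairwise
nonnegative inner products. -/
theorem measureReal_le_averageDist_le (hVm : ∀ p, Measurable fun θ => V θ p)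
    (hB : ∀ θ, ‖V θ‖ ≤ B) (hB0 : 0 < B) (hV : ∀ θ θ', 0 ≤ inner ℝ (V θ) (V θ'))
    (hk : ∀ p, k p = ∫ θ, V θ p ∂ν) (hN : 0 < N) {t : ℝ} (ht : 0 ≤ t) :
    (Measure.pi fun _ : Fin N => ν).real {x | t ≤ averageDist V k x}
      ≤ 2 * Real.exp (-(3 * N * t ^ 2 / (8 * B ^ 2))) := by
  have hN' : (0 : ℝ) < N := Nat.cast_pos.2 hN
  have hs : 0 < √(N : ℝ) := Real.sqrt_pos.2 hN'
  have hss : √(N : ℝ) ^ 2 = N := Real.sq_sqrt hN'.le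
  -- the deviation in units of the bound `B / √N` on its mean
  set u := t * √(N : ℝ) / B with hu
  have hexp : 3 * N * t ^ 2 / (8 * B ^ 2) = 3 / 8 * u ^ 2 := by
    rw [hu, div_pow, mul_pow, hss]
    field_simp
  rw [hexp]
  have hmean := integral_averageDist_le ν hVm hB hB0.le hk hN
  rcases lt_or_ge u 1 with hu1 | hu1
  · refine measureReal_le_one.trans ?_
    have hu0 : 0 ≤ u := by positivity
    have h := Real.add_one_le_exp (-(3 / 8 * u ^ 2))
    nlinarith
  · obtain ⟨c, hc⟩ : ∃ c : NNReal, (c : ℝ) = √2 * B / N :=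
      ⟨⟨√2 * B / N, by positivity⟩, rfl⟩
    have hsub := hasSubgaussianMGF_of_bounded_differences ν (measurable_averageDist (N := N) hVm)
      (averageDist_le hB hN) (c := c)
      (by simpa only [hc] using averageDist_update_le (k := k) hB hV)
    have htB : t = u * (B / √N) := by
      rw [hu]; field_simp
    have hr : 0 ≤ (u - 1) * (B / √(N : ℝ)) :=
      mul_nonneg (sub_nonneg.2 hu1) (by positivity)
    have h := hsub.measure_ge_le hr
    refine (le_trans (measureReal_mono ?_) h).trans ?_
    · intro x hx
      simp only [Set.mem_ofPred_eq] at hx ⊢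
      linarith
    · refine le_trans (le_of_eq ?_) (exp_neg_sub_one_sq_le u)
      congr 1
      have hcc : (2 * ((N * (c / 2) ^ 2 : NNReal) : ℝ)) = B ^ 2 / N := by
        push_cast
        rw [hc, div_pow, div_pow, mul_pow, Real.sq_sqrt zero_le_two]
        field_simp
      rw [hcc, mul_pow, div_pow, hss]
      field_simp

end Average

/-! ### The kernel matrix on the training inputs -/

/-- The entries of a square matrix as a Euclidean vector, whose norm is the Frobenius norm. -/
def entryVector {d : ℕ} (A : Matrix (Fin d) (Fin d) ℝ) : EuclideanSpace ℝ (Fin d × Fin d) :=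
  WithLp.toLp 2 fun p => A p.1 p.2

lemma opNorm_le_norm_entryVector {d : ℕ} (A : Matrix (Fin d) (Fin d) ℝ) :
    opNorm A ≤ ‖entryVector A‖ := by
  refine ContinuousLinearMap.opNorm_le_bound _ (norm_nonneg _) fun v => ?_
  refine le_of_pow_le_pow_left₀ two_ne_zero (by positivity) ?_
  rw [mul_pow, EuclideanSpace.real_norm_sq_eq, EuclideanSpace.real_norm_sq_eq,
    EuclideanSpace.real_norm_sq_eq, Fintype.sum_prod_type, Finset.sum_mul]
  refine Finset.sum_le_sum fun a _ => ?_
  simpa [entryVector, Matrix.mulVec, dotProduct] using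
    Finset.sum_mul_sq_le_sq_mul_sq Finset.univ (fun b => A a b) (fun b => v b)

namespace QNN

variable {X : Type*} {n L m : ℕ}

/-- The empirical kernel matrix on the training inputs at the parameter `θ`, as a vector. -/
def empiricalTrainVector (Q : QNN X n L m) {d : ℕ} (xs : Fin d → X) (θ : Fin L → ℝ) :
    EuclideanSpace ℝ (Fin d × Fin d) :=
  entryVector (Matrix.of fun a b => Q.empiricalNTK θ (xs a) (xs b))

/-- Empirical kernel matrices are Gram matrices, and the Frobenius inner product of two Gram
matrices is a sum of squares. -/
lemma inner_empiricalTrainVector_nonneg (Q : QNN X n L m) {d : ℕ} (xs : Fin d → X)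
    (θ θ' : Fin L → ℝ) :
    0 ≤ inner ℝ (Q.empiricalTrainVector xs θ) (Q.empiricalTrainVector xs θ') := by
  have h : inner ℝ (Q.empiricalTrainVector xs θ) (Q.empiricalTrainVector xs θ')
      = ∑ i, ∑ i', (∑ a, Q.grad θ (xs a) i * Q.grad θ' (xs a) i') ^ 2 := by
    simp only [empiricalTrainVector, entryVector, PiLp.inner_apply, Matrix.of_apply,
      RCLike.inner_apply, conj_trivial, Fintype.sum_prod_type, empiricalNTK, dotProduct,
      sq, Finset.sum_mul_sum]
    calc ∑ a, ∑ b, ∑ i', ∑ i, Q.grad θ' (xs a) i' * Q.grad θ' (xs b) i'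
          * (Q.grad θ (xs a) i * Q.grad θ (xs b) i)
        = ∑ a, ∑ b, ∑ i, ∑ i', Q.grad θ (xs a) i * Q.grad θ' (xs a) i'
          * (Q.grad θ (xs b) i * Q.grad θ' (xs b) i') := by
          refine Finset.sum_congr rfl fun a _ => Finset.sum_congr rfl fun b _ => ?_
          rw [Finset.sum_comm]
          refine Finset.sum_congr rfl fun i _ => Finset.sum_congr rfl fun i' _ => ?_
          ring
      _ = ∑ a, ∑ i, ∑ b, ∑ i', Q.grad θ (xs a) i * Q.grad θ' (xs a) i'
          * (Q.grad θ (xs b) i * Q.grad θ' (xs b) i') :=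
          Finset.sum_congr rfl fun a _ => Finset.sum_comm
      _ = ∑ i, ∑ a, ∑ i', ∑ b, Q.grad θ (xs a) i * Q.grad θ' (xs a) i'
          * (Q.grad θ (xs b) i * Q.grad θ' (xs b) i') := by
          rw [Finset.sum_comm]
          exact Finset.sum_congr rfl fun i _ => Finset.sum_congr rfl fun a _ => Finset.sum_comm
      _ = _ := Finset.sum_congr rfl fun i _ => Finset.sum_comm
  rw [h]
  exact Finset.sum_nonneg fun i _ => Finset.sum_nonneg fun i' _ => sq_nonneg _

lemma norm_empiricalTrainVector_le [Finite X] (Q : QNN X n L m) {d : ℕ} (xs : Fin d → X)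
    (θ : Fin L → ℝ) : ‖Q.empiricalTrainVector xs θ‖ ≤ L * d * Q.supNorm ^ 2 := by
  refine le_of_pow_le_pow_left₀ two_ne_zero (by positivity) ?_
  rw [EuclideanSpace.norm_sq_eq]
  calc ∑ p, ‖Q.empiricalTrainVector xs θ p‖ ^ 2
      ≤ ∑ _p : Fin d × Fin d, (L * Q.supNorm ^ 2) ^ 2 := Finset.sum_le_sum fun p _ =>
        pow_le_pow_left₀ (norm_nonneg _) (Q.abs_empiricalNTK_le θ (xs p.1) (xs p.2)) 2
    _ = (L * d * Q.supNorm ^ 2) ^ 2 := by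
        simp
        ring

end QNN
end CliffordQNN

end

theorem mainTheorem3 {X : Type*} [Finite X] {n L m : ℕ} (Q : CliffordQNN.QNN X n L m)
    {d : ℕ} (xs : Fin d → X) {N : ℕ}
    {Ω : Type*} [MeasurableSpace Ω] (P : MeasureTheory.Measure Ω)
    [MeasureTheory.IsProbabilityMeasure P]
    (θ : Fin N → Ω → Fin L → ℝ)
    (hindep : ProbabilityTheory.iIndepFun θ P)
    (hlaw : ∀ j, ProbabilityTheory.HasLaw (θ j)
      (ProbabilityTheory.uniformOn (CliffordQNN.cliffordAngles L)) P)
    (t : ℝ) (ht : 0 < t) (htf : t ≤ Q.supNorm ^ 2) :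
    P.real {ω | t ≤ CliffordQNN.opNorm
        (Q.estimatedTrain (fun j => θ j ω) xs - Q.analyticTrain xs)} ≤
      2 * (d : ℝ) * Real.exp
        (-(3 * (N : ℝ) * t ^ 2 / (8 * (L : ℝ) ^ 2 * (d : ℝ) ^ 2 * Q.supNorm ^ 4))) := by
  open CliffordQNN MeasureTheory ProbabilityTheory in
  have hF : 0 < Q.supNorm ^ 2 := ht.trans_le htf
  rcases Nat.eq_zero_or_pos d with rfl | hd
  · -- without training inputs the matrices are empty, and `t` is positive
    have hempty : {ω | t ≤ opNorm (Q.estimatedTrain (fun j => θ j ω) xs - Q.analyticTrain xs)}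
        = ∅ := by
      ext ω
      have h0 : opNorm (Q.estimatedTrain (fun j => θ j ω) xs - Q.analyticTrain xs) = 0 := by
        rw [Subsingleton.elim (Q.estimatedTrain (fun j => θ j ω) xs - Q.analyticTrain xs) 0, opNorm,
          map_zero, norm_zero]
      simp [h0, ht]
    rw [hempty]
    simp
  have hd1 : (1 : ℝ) ≤ d := Nat.one_le_cast.2 hd
  -- without samples or without parameters the exponent is zero and the bound exceeds one
  have htriv : ∀ r : ℝ, r = 0 → P.real {ω | t ≤ opNorm
      (Q.estimatedTrain (fun j => θ j ω) xs - Q.analyticTrain xs)}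
      ≤ 2 * (d : ℝ) * Real.exp (-r) := fun r hr => by
    rw [hr, neg_zero, Real.exp_zero]
    exact measureReal_le_one.trans (by linarith)
  rcases Nat.eq_zero_or_pos N with rfl | hN
  · exact htriv _ (by simp)
  rcases Nat.eq_zero_or_pos L with rfl | hL
  · exact htriv _ (by simp)
  set ν := uniformOn (cliffordAngles L) with hν
  have hprob : IsProbabilityMeasure ν := by
    rw [hν, uniformOn_cliffordAngles]
    infer_instance
  have hpi : HasLaw (fun ω j => θ j ω) (Measure.pi fun _ : Fin N => ν) P := hindep.hasLaw_pi hlaw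
  have hVm : ∀ p, Measurable fun φ => Q.empiricalTrainVector xs φ p := fun p =>
    (Q.continuous_empiricalNTK (xs p.1) (xs p.2)).measurable
  have hdist : ∀ ω, ‖entryVector (Q.estimatedTrain (fun j => θ j ω) xs - Q.analyticTrain xs)‖
      = averageDist (Q.empiricalTrainVector xs) (entryVector (Q.analyticTrain xs))
        (fun j => θ j ω) := fun ω => by
    rw [averageDist]
    congr 1
    ext p
    simp [entryVector, QNN.empiricalTrainVector, QNN.estimatedTrain, QNN.estimatedNTK_eq]
  have hconc := measureReal_le_averageDist_le (N := N) ν (V := Q.empiricalTrainVector xs)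
    (k := entryVector (Q.analyticTrain xs)) hVm (Q.norm_empiricalTrainVector_le xs)
    (by positivity) (Q.inner_empiricalTrainVector_nonneg xs)
    (fun p => Q.analyticNTK_eq (xs p.1) (xs p.2)) hN ht.le
  rw [← hpi.measureReal_eq (measurableSet_le measurable_const (measurable_averageDist hVm))]
    at hconc
  have hden : 8 * (L * d * Q.supNorm ^ 2) ^ 2
      = 8 * (L : ℝ) ^ 2 * (d : ℝ) ^ 2 * Q.supNorm ^ 4 := by ring
  rw [hden] at hconc
  refine (measureReal_mono fun ω hω => ?_).trans (hconc.trans ?_)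
  · exact (show t ≤ _ from hω).trans ((opNorm_le_norm_entryVector _).trans (hdist ω).le)
  · exact mul_le_mul_of_nonneg_right (by linarith) (Real.exp_pos _).le
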